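/- Let $m\ge 1$ and $n=\frac{3^m-1}{2}$. Let $H(n,3)$ be the graph on $\mathbb F_3^n$ in which two words are adjacent if they differ in exactly one position. A $1$-perfect code in $H(n,3)$ is an independent set $C$ of vertices such that every vertex outside $C$ is adjacent to exactly one element of $C$; its rank is the dimension of the affine span of $C$ over $\mathbb F_3$, and it is said to be of rank at most $+1$ if its rank is at most $n-m+1$. An automorphism of $H(n,3)$ of the form $\beta(c_0,\dots,c_{n-1})=\big(\theta_0(c_{\pi^{-1}(0)}),\dots,\theta_{n-1}(c_{\pi^{-1}(n-1)})\big)$, with $\pi$ a permutation of the coordinates and $\theta_0,\dots,\theta_{n-1}$ permutations of $\mathbb F_3$, is said to act only on the coordinates $i$ and $j$ if $\pi(k)=k$ and $\theta_k=\mathrm{id}$ for all $k\notin\{i,j\}$. A $1$-perfect code $C'$ is a two-coordinate switching of a $1$-perfect code $C$ if $C'\subseteq C\cup\beta(C)$ for some automorphism $\beta$ that acts only on some coordinates $i$ and $j$ (for $n=1$, $i=j$ is allowed). Then the set of $1$-perfect codes of rank at most $+1$ in $H(n,3)$ is connected with respect to two-coordinate switching: for any two such codes $C$ and $D$ there is a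 finite sequence $C=C_0,C_1,\dots,C_k=D$ of $1$-perfect codes in $H(n,3)$ of rank at most $+1$ such that $C_{l+1}$ is a two-coordinate switching of $C_l$ for every $0\le l<k$. -/

import Mathlib

/-- Words of length `n` over the ternary alphabet, identified with the field of order `3`. -/
abbrev TernaryWord (n : ℕ) : Type := Fin n → ZMod 3

/-- The Hamming graph `H(n,3)`: two words are adjacent if they differ in exactly one position. -/
def ternaryHammingGraph (n : ℕ) : SimpleGraph (TernaryWord n) where
  Adj x y := hammingDist x y = 1
  symm := ⟨fun x y h => by rw [hammingDist_comm]; exact h⟩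
  loopless := ⟨fun x h => by simp at h⟩

/-- A `1`-perfect code in a graph: an independent set of vertices such that every vertex outside
it is adjacent to exactly one of its elements. -/
def IsOnePerfectCode {V : Type*} (G : SimpleGraph V) (C : Set V) : Prop :=
  G.IsIndepSet C ∧ ∀ v, v ∉ C → ∃! c, c ∈ C ∧ G.Adj v c

/-- The rank of a ternary code: the dimension of its affine span. -/
noncomputable def codeRank {n : ℕ} (C : Set (TernaryWord n)) : ℕ :=
  Module.finrank (ZMod 3) (affineSpan (ZMod 3) C).direction

/-- The automorphism `(π, θ)` of `H(n,3)`: the coordinates are permuted by `π`, and then the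
symbol in each position `k` is changed by the permutation `θ k` of the alphabet. -/
def hammingAut {n : ℕ} (π : Equiv.Perm (Fin n)) (θ : Fin n → Equiv.Perm (ZMod 3))
    (c : TernaryWord n) : TernaryWord n :=
  fun k => θ k (c (π.symm k))

/-- `C'` is a two-coordinate switching of `C`: `C' ⊆ C ∪ β(C)` for some automorphism
`β = (π, θ)` such that `π` fixes every coordinate, and `θ` fixes the values of every coordinate,
except maybe the `i`th and the `j`th one. Admitting `i = j` changes nothing for `n ≥ 2`; it gives
the relation its natural meaning when there is only one coordinate. -/
def IsTwoCoordinateSwitching {n : ℕ} (C C' : Set (TernaryWord n)) : Prop :=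
  ∃ (i j : Fin n) (π : Equiv.Perm (Fin n)) (θ : Fin n → Equiv.Perm (ZMod 3)),
    (∀ k, k ≠ i → k ≠ j → π k = k ∧ θ k = Equiv.refl (ZMod 3)) ∧
    C' ⊆ C ∪ hammingAut π θ '' C

/-- The set of ternary `1`-perfect codes of length `n` and of rank at most `(n - m) + r`
(used for `n = (3 ^ m - 1) / 2`, when `n - m` is the dimension of the Hamming code: these are
the codes of rank at most `+r`). -/
def onePerfectCodesOfRankLE (n m r : ℕ) : Set (Set (TernaryWord n)) :=
  {C | IsOnePerfectCode (ternaryHammingGraph n) C ∧ codeRank C ≤ (n - m) + r}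

/-! Every code of rank at most +1 is joined to an affine Hamming code. Such a code `C` lies in a
fibre `φ = b` of a surjective linear map `φ` onto `K`, the space of dimension `m - 1`. Counting
shows that exactly three vectors of weight at most one map to each element of `K`
(`card_ball_fiber`). After sign changes of coordinates, one column of `φ` is zero, at a coordinate
`o`, and the others come in blocks of three equal columns (`exists_isBlockMap`). Then `C` is a graph
`x o = f x` inside the fibre, where `f` ignores coordinate `o` and is Latin: it changes along `e_j -
e_k` for `j`, `k` in one block. Conversely every Latin `f` gives a perfect code.

The alphabet size enters as follows: a bijection of `F_3` is affine, so `f` has a slope on each line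
of direction `e_j - e_k`. Parallel lines joined by another in-block direction carry functions that
never agree, hence have equal slopes (`IsLatin.increment_add`). The slope is thus one of two values,
and where it is wrong, swapping `j` and `k` repairs it; this is a two-coordinate switching. With all
slopes standard, `f = Λ + d` with `Λ` linear and `d` constant along in-block directions, and shifts
of coordinate `o` remove the values 1 and 2 of `d`. What remains is an affine Hamming code.

Any two affine Hamming codes are equivalent, and an equivalence is a product of transpositions of
coordinates and symbol permutations in single coordinates, each of them a switching. Using
switchings valid in both directions makes the chains reversible. -/

open Relation

/-! ### Perfect codes as tilings by balls -/

variable {n m : ℕ}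

/-- The vectors of Hamming weight at most one. -/
def ballVec : Option (Fin n × (ZMod 3)ˣ) → TernaryWord n
  | none => 0
  | some (j, u) => Pi.single j (u : ZMod 3)

theorem hammingDist_eq_one_iff {x y : TernaryWord n} :
    hammingDist x y = 1 ↔ ∃ j, ∃ u : (ZMod 3)ˣ, y = x + ballVec (some (j, u)) := by
  simp only [hammingDist, Finset.card_eq_one, ballVec]
  constructor
  · rintro ⟨j, hj⟩
    have h : ∀ k, x k ≠ y k ↔ k = j := fun k => by
      have := Finset.ext_iff.1 hj k
      simpa using this
    have hne : y j - x j ≠ 0 := fun h0 => (h j).2 rfl (sub_eq_zero.1 h0).symm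
    refine ⟨j, Units.mk0 _ hne, funext fun k => ?_⟩
    by_cases hk : k = j
    · subst hk; simp
    · have : x k = y k := by
        by_contra h'
        exact hk ((h k).1 h')
      simp [hk, this]
  · rintro ⟨j, u, rfl⟩
    refine ⟨j, Finset.ext fun k => ?_⟩
    by_cases hk : k = j
    · subst hk; simp
    · simp [hk]

theorem ballVec_injective : Function.Injective (ballVec (n := n)) := by
  rintro (_ | ⟨j, u⟩) (_ | ⟨k, w⟩) h
  · rfl
  · have := congrFun h k
    simp [ballVec] at this
    exact absurd this.symm w.ne_zero
  · have := congrFun h j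
    simp [ballVec] at this
  · have hj := congrFun h j
    by_cases hjk : j = k
    · subst hjk
      simp only [ballVec, Pi.single_eq_same] at hj
      rw [Units.ext hj]
    · simp [ballVec, hjk] at hj

/-- A code is `1`-perfect if and only if the balls of radius one partition the space. -/
theorem isOnePerfectCode_iff {C : Set (TernaryWord n)} :
    IsOnePerfectCode (ternaryHammingGraph n) C ↔ ∀ v, ∃! e, v + ballVec e ∈ C := by
  have hadj : ∀ x y, (ternaryHammingGraph n).Adj x y ↔
      ∃ j, ∃ u : (ZMod 3)ˣ, y = x + ballVec (some (j, u)) := fun x y => hammingDist_eq_one_iff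
  constructor
  · rintro ⟨hind, hcov⟩ v
    by_cases hv : v ∈ C
    · refine ⟨none, by simpa [ballVec] using hv, ?_⟩
      rintro (_ | ⟨j, u⟩) he
      · rfl
      · have ha := (hadj v _).2 ⟨j, u, rfl⟩
        exact absurd ha (hind hv he ha.ne)
    · obtain ⟨c, ⟨hc, ha⟩, huniq⟩ := hcov v hv
      obtain ⟨j, u, rfl⟩ := (hadj v _).1 ha
      refine ⟨some (j, u), hc, ?_⟩
      rintro (_ | ⟨k, w⟩) he
      · exact absurd (by simpa [ballVec] using he) hv
      · exact ballVec_injective (add_left_cancel (huniq _ ⟨he, (hadj v _).2 ⟨k, w, rfl⟩⟩))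
  · intro h
    constructor
    · intro x hx y hy _ ha
      obtain ⟨j, u, rfl⟩ := (hadj x y).1 ha
      have := (h x).unique (y₁ := none) (y₂ := some (j, u)) (by simpa [ballVec] using hx) hy
      exact absurd this (by simp)
    · intro v hv
      obtain ⟨e, he, huniq⟩ := h v
      rcases e with _ | ⟨j, u⟩
      · exact absurd (by simpa [ballVec] using he) hv
      · refine ⟨_, ⟨he, (hadj v _).2 ⟨j, u, rfl⟩⟩, ?_⟩
        rintro c ⟨hc, ha⟩
        obtain ⟨k, w, rfl⟩ := (hadj v c).1 ha
        rw [huniq _ hc]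

/-! ### Automorphisms of the Hamming graph -/

theorem hammingAut_mul (π π' : Equiv.Perm (Fin n)) (θ θ' : Fin n → Equiv.Perm (ZMod 3))
    (x : TernaryWord n) :
    hammingAut π θ (hammingAut π' θ' x) =
      hammingAut (π * π') (fun k => θ k * θ' (π.symm k)) x := rfl

theorem hammingAut_symm_apply (π : Equiv.Perm (Fin n)) (θ : Fin n → Equiv.Perm (ZMod 3))
    (x : TernaryWord n) :
    hammingAut π⁻¹ (fun k => (θ (π k))⁻¹) (hammingAut π θ x) = x := by
  funext k
  change (θ (π k)).symm (θ (π k) (x (π.symm (π k)))) = x k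
  simp

theorem hammingAut_apply_symm (π : Equiv.Perm (Fin n)) (θ : Fin n → Equiv.Perm (ZMod 3))
    (x : TernaryWord n) :
    hammingAut π θ (hammingAut π⁻¹ (fun k => (θ (π k))⁻¹) x) = x := by
  funext k
  simp [hammingAut, ← Equiv.Perm.inv_def]

theorem hammingAut_injective (π : Equiv.Perm (Fin n)) (θ : Fin n → Equiv.Perm (ZMod 3)) :
    Function.Injective (hammingAut π θ) :=
  Function.LeftInverse.injective (hammingAut_symm_apply π θ)

theorem hammingAut_surjective (π : Equiv.Perm (Fin n)) (θ : Fin n → Equiv.Perm (ZMod 3)) :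
    Function.Surjective (hammingAut π θ) :=
  Function.RightInverse.surjective (hammingAut_apply_symm π θ)

theorem hammingDist_hammingAut (π : Equiv.Perm (Fin n)) (θ : Fin n → Equiv.Perm (ZMod 3))
    (x y : TernaryWord n) :
    hammingDist (hammingAut π θ x) (hammingAut π θ y) = hammingDist x y := by
  simp only [hammingDist, hammingAut, ne_eq, (θ _).injective.eq_iff]
  exact Finset.card_equiv π.symm (by simp)

theorem IsOnePerfectCode.image_hammingAut {C : Set (TernaryWord n)}
    (hC : IsOnePerfectCode (ternaryHammingGraph n) C)
    (π : Equiv.Perm (Fin n)) (θ : Fin n → Equiv.Perm (ZMod 3)) :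
    IsOnePerfectCode (ternaryHammingGraph n) (hammingAut π θ '' C) := by
  have hadj : ∀ x y, (ternaryHammingGraph n).Adj (hammingAut π θ x) (hammingAut π θ y) ↔
      (ternaryHammingGraph n).Adj x y := fun x y => by
    change hammingDist _ _ = 1 ↔ hammingDist _ _ = 1
    rw [hammingDist_hammingAut]
  constructor
  · rintro _ ⟨x, hx, rfl⟩ _ ⟨y, hy, rfl⟩ hne
    rw [hadj]
    exact hC.1 hx hy (fun h => hne (congrArg _ h))
  · intro v hv
    obtain ⟨w, rfl⟩ := hammingAut_surjective π θ v
    obtain ⟨c, ⟨hc, ha⟩, hu⟩ := hC.2 w (fun h => hv ⟨w, h, rfl⟩)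
    refine ⟨_, ⟨⟨c, hc, rfl⟩, (hadj _ _).2 ha⟩, ?_⟩
    rintro _ ⟨⟨c', hc', rfl⟩, ha'⟩
    rw [hu c' ⟨hc', (hadj _ _).1 ha'⟩]

/-- The symmetric group on three symbols is the affine group of `F_3`. Hence all automorphisms of
`H(n,3)` are affine maps, and the rank is invariant under equivalence. -/
theorem perm_zmod_three_affine (σ : Equiv.Perm (ZMod 3)) :
    ∃ a b : ZMod 3, ∀ z, σ z = a * z + b := by
  revert σ
  decide

theorem codeRank_image_hammingAut_le (C : Set (TernaryWord n))
    (π : Equiv.Perm (Fin n)) (θ : Fin n → Equiv.Perm (ZMod 3)) :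
    codeRank (hammingAut π θ '' C) ≤ codeRank C := by
  choose a b hab using fun k => perm_zmod_three_affine (θ k)
  let A : TernaryWord n →ᵃ[ZMod 3] TernaryWord n :=
    { toFun := hammingAut π θ
      linear := LinearMap.pi fun k => a k • LinearMap.proj (π.symm k)
      map_vadd' := fun p v => by
        funext k
        simp [hammingAut, hab]
        ring }
  have h : (hammingAut π θ '' C) = A '' C := rfl
  rw [codeRank, codeRank, direction_affineSpan, direction_affineSpan, h,
    ← AffineMap.map_vectorSpan]
  exact Submodule.finrank_map_le _ _

theorem image_hammingAut_mem {r : ℕ} {C : Set (TernaryWord n)}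
    (hC : C ∈ onePerfectCodesOfRankLE n m r)
    (π : Equiv.Perm (Fin n)) (θ : Fin n → Equiv.Perm (ZMod 3)) :
    hammingAut π θ '' C ∈ onePerfectCodesOfRankLE n m r :=
  ⟨hC.1.image_hammingAut π θ, (codeRank_image_hammingAut_le C π θ).trans hC.2⟩

/-! ### Chains of switchings and equivalent codes -/

/-- Mutual two-coordinate switchings inside the class of `1`-perfect codes of rank at most `+r`. -/
def MutualSwitching (n m r : ℕ) (C D : Set (TernaryWord n)) : Prop :=
  C ∈ onePerfectCodesOfRankLE n m r ∧ D ∈ onePerfectCodesOfRankLE n m r ∧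
    IsTwoCoordinateSwitching C D ∧ IsTwoCoordinateSwitching D C

/-- Connectedness by chains of mutual two-coordinate switchings. -/
def SwitchConnected (n m r : ℕ) : Set (TernaryWord n) → Set (TernaryWord n) → Prop :=
  ReflTransGen (MutualSwitching n m r)

theorem SwitchConnected.symm {r : ℕ} {C D : Set (TernaryWord n)}
    (h : SwitchConnected n m r C D) : SwitchConnected n m r D C := by
  have : Std.Symm (MutualSwitching n m r) := ⟨fun _ _ h => ⟨h.2.1, h.1, h.2.2.2, h.2.2.1⟩⟩
  exact symm_of (ReflTransGen (MutualSwitching n m r)) h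

theorem SwitchConnected.reflTransGen {r : ℕ} {C D : Set (TernaryWord n)}
    (h : SwitchConnected n m r C D) (hC : C ∈ onePerfectCodesOfRankLE n m r)
    (hD : D ∈ onePerfectCodesOfRankLE n m r) :
    ReflTransGen
      (fun A B : onePerfectCodesOfRankLE n m r =>
        IsTwoCoordinateSwitching (A : Set (TernaryWord n)) (B : Set (TernaryWord n)))
      ⟨C, hC⟩ ⟨D, hD⟩ := by
  induction h with
  | refl => exact .refl
  | tail _ hs ih => exact (ih hs.1).tail hs.2.2.1

theorem SwitchConnected.mem {r : ℕ} {C D : Set (TernaryWord n)}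
    (h : SwitchConnected n m r C D) (hC : C ∈ onePerfectCodesOfRankLE n m r) :
    D ∈ onePerfectCodesOfRankLE n m r := by
  induction h with
  | refl => exact hC
  | tail _ hs _ => exact hs.2.1

theorem switchConnected_image_of_two_coordinates {r : ℕ} {C : Set (TernaryWord n)}
    (hC : C ∈ onePerfectCodesOfRankLE n m r) (i j : Fin n)
    (π : Equiv.Perm (Fin n)) (θ : Fin n → Equiv.Perm (ZMod 3))
    (h : ∀ k, k ≠ i → k ≠ j → π k = k ∧ θ k = Equiv.refl (ZMod 3)) :
    SwitchConnected n m r C (hammingAut π θ '' C) := by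
  refine .single ⟨hC, image_hammingAut_mem hC π θ, ⟨i, j, π, θ, h, Set.subset_union_right⟩,
    ⟨i, j, π⁻¹, fun k => (θ (π k))⁻¹, fun k hi hj => ?_, ?_⟩⟩
  · obtain ⟨h1, h2⟩ := h k hi hj
    refine ⟨Equiv.Perm.inv_eq_iff_eq.2 h1.symm, ?_⟩
    change (θ (π k))⁻¹ = _
    rw [h1, h2]
    rfl
  · intro x hx
    exact .inr ⟨_, ⟨x, hx, rfl⟩, hammingAut_symm_apply π θ x⟩

theorem image_hammingAut_image (π π' : Equiv.Perm (Fin n)) (θ θ' : Fin n → Equiv.Perm (ZMod 3))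
    (C : Set (TernaryWord n)) :
    hammingAut π θ '' (hammingAut π' θ' '' C) =
      hammingAut (π * π') (fun k => θ k * θ' (π.symm k)) '' C := by
  rw [Set.image_image]
  simp only [hammingAut_mul]

theorem switchConnected_image_perm {r : ℕ} {C : Set (TernaryWord n)}
    (hC : C ∈ onePerfectCodesOfRankLE n m r) (π : Equiv.Perm (Fin n)) :
    SwitchConnected n m r C (hammingAut π 1 '' C) := by
  induction π using Equiv.Perm.swap_induction_on with
  | one =>
    rw [show hammingAut 1 1 = (id : TernaryWord n → _) from rfl, Set.image_id]
    exact .refl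
  | swap_mul f x y hxy ih =>
    have h := switchConnected_image_of_two_coordinates (ih.mem hC) x y (Equiv.swap x y) 1
      (fun k hx hy => ⟨Equiv.swap_apply_of_ne_of_ne hx hy, rfl⟩)
    rw [image_hammingAut_image] at h
    exact ReflTransGen.trans ih h

theorem switchConnected_image_symbols {r : ℕ} {C : Set (TernaryWord n)}
    (hC : C ∈ onePerfectCodesOfRankLE n m r) (s : Finset (Fin n)) :
    ∀ θ : Fin n → Equiv.Perm (ZMod 3), (∀ k ∉ s, θ k = 1) →
    SwitchConnected n m r C (hammingAut 1 θ '' C) := by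
  induction s using Finset.induction_on with
  | empty =>
    intro θ h
    obtain rfl : θ = 1 := funext fun k => h k (by simp)
    rw [show hammingAut 1 1 = (id : TernaryWord n → _) from rfl, Set.image_id]
    exact .refl
  | insert a s ha ih =>
    intro θ hθ
    have ih' := ih (Function.update θ a 1) (fun k hk => by
      by_cases hka : k = a
      · subst hka; simp
      · rw [Function.update_of_ne hka]
        exact hθ k (by simp [hk, hka]))
    have h := switchConnected_image_of_two_coordinates (ih'.mem hC) a a 1
      (Function.update 1 a (θ a)) (fun k hx _ => ⟨rfl, by
        rw [Function.update_of_ne hx]; rfl⟩)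
    rw [image_hammingAut_image] at h
    have e : (fun k => (Function.update (1 : Fin n → Equiv.Perm (ZMod 3)) a (θ a)) k *
        Function.update θ a 1 ((1 : Equiv.Perm (Fin n)).symm k)) = θ := by
      funext k
      change Function.update (1 : Fin n → Equiv.Perm (ZMod 3)) a (θ a) k *
        Function.update θ a 1 k = θ k
      by_cases hka : k = a
      · subst hka
        rw [Function.update_self, Function.update_self, mul_one]
      · rw [Function.update_of_ne hka, Function.update_of_ne hka, Pi.one_apply, one_mul]
    rw [e] at h
    exact ReflTransGen.trans ih' h

/-- Equivalent codes are connected by switchings. -/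
theorem switchConnected_image {r : ℕ} {C : Set (TernaryWord n)}
    (hC : C ∈ onePerfectCodesOfRankLE n m r)
    (π : Equiv.Perm (Fin n)) (θ : Fin n → Equiv.Perm (ZMod 3)) :
    SwitchConnected n m r C (hammingAut π θ '' C) := by
  have h1 := switchConnected_image_perm hC π
  have h2 := switchConnected_image_symbols (h1.mem hC) Finset.univ θ (by simp)
  rw [image_hammingAut_image] at h2
  exact ReflTransGen.trans h1 h2

/-! ### Block maps, Latin functions and their graph codes -/

section Latin

variable {K : Type*} [AddCommGroup K] [Module (ZMod 3) K]

/-- The difference of two unit vectors. -/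
def unitDiff (j k : Fin n) : TernaryWord n := Pi.single j 1 - Pi.single k 1

/-- The linear map `φ` vanishes on exactly one unit vector, with index `o`, and each nonzero vector
of the codomain is, up to a common sign, the image of exactly three unit vectors. -/
structure IsBlockMap (φ : TernaryWord n →ₗ[ZMod 3] K) (o : Fin n) : Prop where
  zero_iff : ∀ j, φ (Pi.single j 1) = 0 ↔ j = o
  block : ∀ r ≠ 0, ∃ u : (ZMod 3)ˣ, ∃ j₁ j₂ j₃, j₁ ≠ j₂ ∧ j₁ ≠ j₃ ∧ j₂ ≠ j₃ ∧
    ∀ k (w : (ZMod 3)ˣ), φ (ballVec (some (k, w))) = r ↔ w = u ∧ (k = j₁ ∨ k = j₂ ∨ k = j₃)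

/-- A function on words that does not depend on the coordinate `o` and changes its value along
the difference of any two unit vectors with the same image under `φ`. -/
structure IsLatin (φ : TernaryWord n →ₗ[ZMod 3] K) (o : Fin n) (f : TernaryWord n → ZMod 3) :
    Prop where
  add_single : ∀ x t, f (x + Pi.single o t) = f x
  ne : ∀ x j k, j ≠ k → φ (Pi.single j 1) = φ (Pi.single k 1) → f (x + unitDiff j k) ≠ f x

/-- The words with a given image under `φ` whose coordinate `o` is a given function. -/
def graphCode (φ : TernaryWord n →ₗ[ZMod 3] K) (b : K) (o : Fin n) (f : TernaryWord n → ZMod 3) :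
    Set (TernaryWord n) :=
  {x | φ x = b ∧ x o = f x}

variable {φ : TernaryWord n →ₗ[ZMod 3] K} {o : Fin n} {f : TernaryWord n → ZMod 3} {b : K}

theorem map_single_eq_smul (φ : TernaryWord n →ₗ[ZMod 3] K) (j : Fin n) (t : ZMod 3) :
    φ (Pi.single j t) = t • φ (Pi.single j 1) := by
  rw [← map_smul, ← Pi.single_smul, smul_eq_mul, mul_one]

theorem map_unitDiff {j k : Fin n} (h : φ (Pi.single j 1) = φ (Pi.single k 1)) :
    φ (unitDiff j k) = 0 := by
  rw [unitDiff, map_sub, h, sub_self]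

theorem unitDiff_swap (j k : Fin n) : unitDiff k j = -unitDiff j k := by
  simp [unitDiff]

/-- The three values of `f` on a line of this direction are distinct, and a bijection of `F_3` is
affine. -/
theorem IsLatin.add_smul_unitDiff (hf : IsLatin φ o f) (x : TernaryWord n) (t : ZMod 3)
    {j k : Fin n} (hjk : j ≠ k) (h : φ (Pi.single j 1) = φ (Pi.single k 1)) :
    f (x + t • unitDiff j k) = f x + t * (f (x + unitDiff j k) - f x) := by
  have key : ∀ a b c : ZMod 3, b ≠ a → c ≠ b → a ≠ c → c = a + 2 * (b - a) := by decide
  have h1 := hf.ne x j k hjk h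
  have h2 := hf.ne (x + unitDiff j k) j k hjk h
  have h3 := hf.ne (x + unitDiff j k + unitDiff j k) j k hjk h
  have e3 : x + unitDiff j k + unitDiff j k + unitDiff j k = x := by
    have : (3 : ZMod 3) • unitDiff j k = 0 := by
      rw [show (3 : ZMod 3) = 0 by decide, zero_smul]
    rw [add_assoc, add_assoc, show unitDiff j k + (unitDiff j k + unitDiff j k) =
      (3 : ZMod 3) • unitDiff j k by module, this, add_zero]
  have e2 : x + (2 : ZMod 3) • unitDiff j k = x + unitDiff j k + unitDiff j k := by module
  rw [e3] at h3
  obtain rfl | rfl | rfl : t = 0 ∨ t = 1 ∨ t = 2 := by revert t; decide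
  · simp
  · simp
  · rw [e2]
    exact key _ _ _ h1 h2 h3

theorem IsLatin.add_smul_unitDiff_ne (hf : IsLatin φ o f) (x : TernaryWord n) {t : ZMod 3}
    (ht : t ≠ 0) {j k : Fin n} (hjk : j ≠ k) (h : φ (Pi.single j 1) = φ (Pi.single k 1)) :
    f (x + t • unitDiff j k) ≠ f x := by
  rw [hf.add_smul_unitDiff x t hjk h]
  simpa [sub_eq_zero, ht] using hf.ne x j k hjk h

theorem IsLatin.sub_unitDiff (hf : IsLatin φ o f) (x : TernaryWord n) {j k : Fin n}
    (hjk : j ≠ k) (h : φ (Pi.single j 1) = φ (Pi.single k 1)) :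
    f (x + unitDiff k j) - f x = -(f (x + unitDiff j k) - f x) := by
  have := hf.add_smul_unitDiff x (-1) hjk h
  rw [neg_one_smul, ← unitDiff_swap] at this
  rw [this]
  ring

/-- The increments of a Latin function along same-image differences are constant along
same-image differences. -/
theorem IsLatin.increment_add (hf : IsLatin φ o f) (x : TernaryWord n) {j k j' k' : Fin n}
    (h : φ (Pi.single j 1) = φ (Pi.single k 1))
    (h' : φ (Pi.single j' 1) = φ (Pi.single k' 1)) (t : ZMod 3) :
    f (x + t • unitDiff j' k' + unitDiff j k) - f (x + t • unitDiff j' k') =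
      f (x + unitDiff j k) - f x := by
  -- Two affine functions on `F_3` with different slopes agree somewhere.
  have key : ∀ a b c d : ZMod 3, (∀ t, c + t * d ≠ a + t * b) → d = b := by decide
  rcases eq_or_ne j k with rfl | hjk
  · simp [unitDiff]
  rcases eq_or_ne j' k' with rfl | hjk'
  · simp [unitDiff]
  rcases eq_or_ne t 0 with rfl | ht
  · simp
  refine key (f x) _ (f (x + t • unitDiff j' k')) _ fun s hs => ?_
  rw [← hf.add_smul_unitDiff _ s hjk h, ← hf.add_smul_unitDiff _ s hjk h,
    add_right_comm] at hs
  exact hf.add_smul_unitDiff_ne _ ht hjk' h' hs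

/-- The increments of a Latin function on one block are determined by any one of them. -/
theorem IsLatin.increment_eq (hf : IsLatin φ o f) (τ : Fin n → ZMod 3)
    (hτ : ∀ j k, j ≠ k → φ (Pi.single j 1) = φ (Pi.single k 1) → τ j ≠ τ k)
    (x : TernaryWord n) {j k : Fin n} (hjk : j ≠ k)
    (h : φ (Pi.single j 1) = φ (Pi.single k 1))
    (hd : f (x + unitDiff j k) - f x = τ j - τ k) (j' k' : Fin n)
    (hj' : φ (Pi.single j' 1) = φ (Pi.single j 1))
    (hk' : φ (Pi.single k' 1) = φ (Pi.single j 1)) :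
    f (x + unitDiff j' k') - f x = τ j' - τ k' := by
  -- Given one nonzero increment `p`, the other nonzero increment from the same point is the only
  -- remaining element of `F_3`.
  have key : ∀ p q r : ZMod 3, p ≠ 0 → q ≠ 0 → q ≠ p → r ≠ 0 → r ≠ p → q = r := by decide
  have star : ∀ j k l, j ≠ k → φ (Pi.single j 1) = φ (Pi.single k 1) →
      φ (Pi.single l 1) = φ (Pi.single j 1) →
      f (x + unitDiff j k) - f x = τ j - τ k → f (x + unitDiff j l) - f x = τ j - τ l := by
    intro j k l hjk hc hl hd
    rcases eq_or_ne l j with rfl | hlj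
    · simp [unitDiff]
    rcases eq_or_ne l k with rfl | hlk
    · exact hd
    have e : x + unitDiff j k = x + unitDiff j l + unitDiff l k := by
      simp only [unitDiff]; abel
    have hne : f (x + unitDiff j k) ≠ f (x + unitDiff j l) :=
      e ▸ hf.ne (x + unitDiff j l) l k hlk (hl.trans hc)
    refine key (τ j - τ k) _ _ (sub_ne_zero.2 (hτ j k hjk hc))
      (sub_ne_zero.2 (hf.ne x j l hlj.symm hl.symm)) ?_
      (sub_ne_zero.2 (hτ j l hlj.symm hl.symm)) fun he => hτ l k hlk (hl.trans hc) ?_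
    · rw [← hd]
      exact fun he => hne (sub_left_injective he).symm
    · exact sub_right_injective he
  rcases eq_or_ne j' j with rfl | hne
  · exact star _ _ _ hjk h hk' hd
  · refine star j' j k' hne hj' (hk'.trans hj'.symm) ?_
    rw [hf.sub_unitDiff x hne.symm hj'.symm, star _ _ _ hjk h hj' hd]
    ring

/-- Graph codes of Latin functions are perfect. -/
theorem IsBlockMap.isOnePerfectCode (hφ : IsBlockMap φ o) (hf : IsLatin φ o f) (b : K) :
    IsOnePerfectCode (ternaryHammingGraph n) (graphCode φ b o f) := by
  rw [isOnePerfectCode_iff]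
  intro v
  have hmem : ∀ e, v + ballVec e ∈ graphCode φ b o f ↔
      φ (ballVec e) = b - φ v ∧ v o + ballVec e o = f (v + ballVec e) := fun e => by
    rw [graphCode, Set.mem_ofPred_eq, map_add, eq_sub_iff_add_eq', Pi.add_apply]
  simp only [hmem]
  -- If `v` is in the fibre, only coordinate `o` may be altered, and its correct value is `f v`.
  -- Otherwise the three columns of a block are available; they leave coordinate `o` alone and give
  -- `f` three distinct values, one of which is `v o`.
  rcases eq_or_ne (b - φ v) 0 with hr | hr
  · rw [hr]
    rcases eq_or_ne (f v) (v o) with h0 | h0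
    · refine ⟨none, by simp [ballVec, h0], ?_⟩
      rintro (_ | ⟨j, u⟩) ⟨h1, h2⟩
      · rfl
      · rw [ballVec, map_single_eq_smul, smul_eq_zero_iff_right u.ne_zero, hφ.zero_iff] at h1
        subst h1
        rw [ballVec, hf.add_single, h0, Pi.single_eq_same] at h2
        exact absurd (left_eq_add.1 h2.symm) u.ne_zero
    · have hne : f v - v o ≠ 0 := sub_ne_zero.2 h0
      refine ⟨some (o, Units.mk0 _ hne), ⟨?_, ?_⟩, ?_⟩
      · rw [ballVec, map_single_eq_smul, (hφ.zero_iff o).2 rfl, smul_zero]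
      · simp [ballVec, hf.add_single]
      rintro (_ | ⟨j, u⟩) ⟨h1, h2⟩
      · simp [ballVec] at h2
        exact absurd h2.symm h0
      · rw [ballVec, map_single_eq_smul, smul_eq_zero_iff_right u.ne_zero, hφ.zero_iff] at h1
        subst h1
        rw [ballVec, hf.add_single, Pi.single_eq_same] at h2
        have : u = Units.mk0 _ hne := Units.ext (by simp [← h2])
        rw [this]
  · obtain ⟨u, j₁, j₂, j₃, h12, h13, h23, hblock⟩ := hφ.block _ hr
    have hcol : ∀ j, (j = j₁ ∨ j = j₂ ∨ j = j₃) → φ (Pi.single j (u : ZMod 3)) = b - φ v :=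
      fun j hj => (hblock j u).2 ⟨rfl, hj⟩
    have hne : ∀ j k, j ≠ k → (j = j₁ ∨ j = j₂ ∨ j = j₃) → (k = j₁ ∨ k = j₂ ∨ k = j₃) →
        f (v + Pi.single j (u : ZMod 3)) ≠ f (v + Pi.single k (u : ZMod 3)) := by
      intro j k hjk hj hk
      have e : v + Pi.single j (u : ZMod 3) =
          v + Pi.single k (u : ZMod 3) + (u : ZMod 3) • unitDiff j k := by
        rw [unitDiff, smul_sub, ← Pi.single_smul, ← Pi.single_smul, smul_eq_mul, mul_one]
        abel
      have hc : φ (Pi.single j 1) = φ (Pi.single k 1) := by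
        have := (hcol j hj).trans (hcol k hk).symm
        rwa [map_single_eq_smul, map_single_eq_smul φ k, ← Units.smul_def, ← Units.smul_def,
          smul_left_cancel_iff] at this
      rw [e]
      exact hf.add_smul_unitDiff_ne _ u.ne_zero hjk hc
    have ho : ∀ j, (j = j₁ ∨ j = j₂ ∨ j = j₃) → (Pi.single j (u : ZMod 3) : TernaryWord n) o = 0 :=
      fun j hj => by
        refine Pi.single_eq_of_ne ?_ _
        rintro rfl
        have := hcol _ hj
        rw [map_single_eq_smul, (hφ.zero_iff _).2 rfl, smul_zero] at this
        exact hr this.symm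
    have key : ∀ a b c d : ZMod 3, a ≠ b → a ≠ c → b ≠ c → d = a ∨ d = b ∨ d = c := by decide
    have hex : ∃ j, (j = j₁ ∨ j = j₂ ∨ j = j₃) ∧ v o = f (v + Pi.single j (u : ZMod 3)) := by
      rcases key _ _ _ (v o) (hne j₁ j₂ h12 (by simp) (by simp))
        (hne j₁ j₃ h13 (by simp) (by simp)) (hne j₂ j₃ h23 (by simp) (by simp)) with h | h | h
      exacts [⟨j₁, by simp, h⟩, ⟨j₂, by simp, h⟩, ⟨j₃, by simp, h⟩]
    obtain ⟨j, hj, hv⟩ := hex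
    refine ⟨some (j, u), ⟨hcol j hj, by rw [ballVec, ho j hj, add_zero, hv]⟩, ?_⟩
    rintro (_ | ⟨k, w⟩) ⟨h1, h2⟩
    · rw [ballVec, map_zero] at h1
      exact absurd h1.symm hr
    · obtain ⟨rfl, hk⟩ := (hblock k w).1 h1
      rw [ballVec, ho k hk, add_zero, hv] at h2
      by_contra hkj
      exact hne j k (fun h => hkj (by rw [h])) hj hk h2

end Latin

/-! ### Switching a graph code to a linear one -/

section Switching

variable {K : Type*} [AddCommGroup K] [Module (ZMod 3) K]
variable {φ : TernaryWord n →ₗ[ZMod 3] K} {o : Fin n} {f : TernaryWord n → ZMod 3} {b : K}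

theorem codeRank_le_of_map_eq [Module.Finite (ZMod 3) K] (hs : Function.Surjective φ)
    (hK : Module.finrank (ZMod 3) K + 1 = m) {C : Set (TernaryWord n)} (hC : ∀ x ∈ C, φ x = b) :
    codeRank C ≤ n - m + 1 := by
  have hle : vectorSpan (ZMod 3) C ≤ LinearMap.ker φ := by
    refine Submodule.span_le.2 ?_
    rintro _ ⟨x, hx, y, hy, rfl⟩
    simp [hC x hx, hC y hy]
  have h1 : codeRank C ≤ Module.finrank (ZMod 3) (LinearMap.ker φ) := by
    rw [codeRank, direction_affineSpan]
    exact Submodule.finrank_mono hle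
  have h2 := LinearMap.finrank_range_add_finrank_ker φ
  rw [LinearMap.range_eq_top.2 hs, finrank_top, Module.finrank_fin_fun] at h2
  replace h2 : Module.finrank (ZMod 3) K + Module.finrank (ZMod 3) (LinearMap.ker φ) = n := h2
  omega

theorem IsBlockMap.graphCode_mem [Module.Finite (ZMod 3) K] (hφ : IsBlockMap φ o)
    (hs : Function.Surjective φ) (hK : Module.finrank (ZMod 3) K + 1 = m) (hf : IsLatin φ o f)
    (b : K) : graphCode φ b o f ∈ onePerfectCodesOfRankLE n m 1 :=
  ⟨hφ.isOnePerfectCode hf b, codeRank_le_of_map_eq hs hK fun _ hx => hx.1⟩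

theorem comp_swap_eq (x : TernaryWord n) {j k : Fin n} (hjk : j ≠ k) :
    x ∘ Equiv.swap j k = x + (x k - x j) • unitDiff j k := by
  funext l
  rcases eq_or_ne l j with rfl | hj
  · simp [unitDiff, hjk]
  rcases eq_or_ne l k with rfl | hk
  · simp [unitDiff, hj]
  · simp [unitDiff, hj, hk, Equiv.swap_apply_of_ne_of_ne hj hk]

theorem unitDiff_comp_swap (i l j k : Fin n) :
    unitDiff i l ∘ Equiv.swap j k = unitDiff (Equiv.swap j k i) (Equiv.swap j k l) := by
  funext a
  simp [unitDiff, Pi.single_apply, Equiv.swap_apply_eq_iff]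

theorem single_comp_swap {o j k : Fin n} (hj : o ≠ j) (hk : o ≠ k) (t : ZMod 3) :
    (Pi.single o t : TernaryWord n) ∘ Equiv.swap j k = Pi.single o t := by
  funext a
  simp [Pi.single_apply, Equiv.swap_apply_eq_iff, Equiv.swap_apply_of_ne_of_ne hj hk]

theorem IsBlockMap.ne_of_eq (hφ : IsBlockMap φ o) {j k : Fin n} (hjk : j ≠ k)
    (h : φ (Pi.single j 1) = φ (Pi.single k 1)) : o ≠ j ∧ o ≠ k := by
  constructor
  · rintro rfl
    exact hjk ((hφ.zero_iff k).1 (h ▸ (hφ.zero_iff o).2 rfl)).symm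
  · rintro rfl
    exact hjk ((hφ.zero_iff j).1 (h.trans ((hφ.zero_iff o).2 rfl)))

open Classical in
/-- Swap the coordinates `j` and `k` of the argument where the increment of `f` along their
difference is not equal to `s`. -/
noncomputable def straighten (j k : Fin n) (s : ZMod 3) (f : TernaryWord n → ZMod 3)
    (x : TernaryWord n) : ZMod 3 :=
  if f (x + unitDiff j k) - f x = s then f x else f (x ∘ Equiv.swap j k)

theorem straighten_of_eq {j k : Fin n} {s : ZMod 3} {x : TernaryWord n}
    (h : f (x + unitDiff j k) - f x = s) : straighten j k s f x = f x := if_pos h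

theorem straighten_of_ne {j k : Fin n} {s : ZMod 3} {x : TernaryWord n}
    (h : f (x + unitDiff j k) - f x ≠ s) : straighten j k s f x = f (x ∘ Equiv.swap j k) :=
  if_neg h

theorem map_swap {j k : Fin n} (h : φ (Pi.single j 1) = φ (Pi.single k 1)) (i : Fin n) :
    φ (Pi.single (Equiv.swap j k i) 1) = φ (Pi.single i 1) := by
  rcases eq_or_ne i j with rfl | hj
  · rw [Equiv.swap_apply_left, h]
  rcases eq_or_ne i k with rfl | hk
  · rw [Equiv.swap_apply_right, h]
  · rw [Equiv.swap_apply_of_ne_of_ne hj hk]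

theorem IsLatin.straighten_increment_of_eq (hf : IsLatin φ o f) {j k : Fin n}
    (h : φ (Pi.single j 1) = φ (Pi.single k 1)) {s : ZMod 3}
    {x : TernaryWord n} (hx : f (x + unitDiff j k) - f x = s) {i l : Fin n}
    (hil : φ (Pi.single i 1) = φ (Pi.single l 1)) :
    straighten j k s f (x + unitDiff i l) - straighten j k s f x =
      f (x + unitDiff i l) - f x := by
  have := hf.increment_add x h hil 1
  rw [one_smul] at this
  rw [straighten_of_eq hx, straighten_of_eq (this.trans hx)]

theorem IsLatin.straighten_increment_of_ne (hf : IsLatin φ o f) {j k : Fin n} (hjk : j ≠ k)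
    (h : φ (Pi.single j 1) = φ (Pi.single k 1)) {s : ZMod 3}
    {x : TernaryWord n} (hx : f (x + unitDiff j k) - f x ≠ s) {i l : Fin n}
    (hil : φ (Pi.single i 1) = φ (Pi.single l 1)) :
    straighten j k s f (x + unitDiff i l) - straighten j k s f x =
      f (x + unitDiff (Equiv.swap j k i) (Equiv.swap j k l)) - f x := by
  have := hf.increment_add x h hil 1
  rw [one_smul] at this
  rw [straighten_of_ne hx, straighten_of_ne (this.trans_ne hx),
    show (x + unitDiff i l) ∘ Equiv.swap j k =
      x ∘ Equiv.swap j k + unitDiff i l ∘ Equiv.swap j k from rfl,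
    unitDiff_comp_swap, comp_swap_eq x hjk]
  exact hf.increment_add x (by rw [map_swap h, map_swap h, hil]) h _

/-- In-block steps do not change the increment that decides on the swap, so both ends of such a step
use the same branch, and the swap preserves blocks. -/
theorem IsBlockMap.isLatin_straighten (hφ : IsBlockMap φ o) (hf : IsLatin φ o f) {j k : Fin n}
    (hjk : j ≠ k) (h : φ (Pi.single j 1) = φ (Pi.single k 1)) (s : ZMod 3) :
    IsLatin φ o (straighten j k s f) := by
  obtain ⟨hoj, hok⟩ := hφ.ne_of_eq hjk h
  constructor
  · intro x t
    have e : (x + Pi.single o t) ∘ Equiv.swap j k = x ∘ Equiv.swap j k + Pi.single o t := by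
      rw [show (x + Pi.single o t) ∘ Equiv.swap j k =
        x ∘ Equiv.swap j k + (Pi.single o t : TernaryWord n) ∘ Equiv.swap j k from rfl,
        single_comp_swap hoj hok]
    rw [straighten, straighten, e, add_right_comm, hf.add_single, hf.add_single, hf.add_single]
  · intro x i l hil hc
    rw [← sub_ne_zero]
    by_cases hx : f (x + unitDiff j k) - f x = s
    · rw [hf.straighten_increment_of_eq h hx hc, sub_ne_zero]
      exact hf.ne x i l hil hc
    · rw [hf.straighten_increment_of_ne hjk h hx hc, sub_ne_zero]
      exact hf.ne x _ _ ((Equiv.swap j k).injective.ne hil) (by rw [map_swap h, map_swap h, hc])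

/-- The decisive increment is also invariant under the swap itself, so the codewords with the wrong
increment are replaced exactly by their swapped copies. -/
theorem IsBlockMap.switchConnected_straighten [Module.Finite (ZMod 3) K] (hφ : IsBlockMap φ o)
    (hs : Function.Surjective φ) (hK : Module.finrank (ZMod 3) K + 1 = m)
    (hf : IsLatin φ o f) {j k : Fin n}
    (hjk : j ≠ k) (h : φ (Pi.single j 1) = φ (Pi.single k 1)) (s : ZMod 3) :
    SwitchConnected n m 1 (graphCode φ b o f) (graphCode φ b o (straighten j k s f)) := by
  obtain ⟨hoj, hok⟩ := hφ.ne_of_eq hjk h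
  have hsw : ∀ x : TernaryWord n, φ (x ∘ Equiv.swap j k) = φ x := fun x => by
    rw [comp_swap_eq x hjk, map_add, map_smul, map_unitDiff h, smul_zero, add_zero]
  have hso : ∀ x : TernaryWord n, (x ∘ Equiv.swap j k) o = x o := fun x => by
    simp [Equiv.swap_apply_of_ne_of_ne hoj hok]
  have hss : ∀ x : TernaryWord n, (x ∘ Equiv.swap j k) ∘ Equiv.swap j k = x := fun x => by
    funext i
    simp
  have hcond : ∀ x : TernaryWord n, f (x ∘ Equiv.swap j k + unitDiff j k) -
      f (x ∘ Equiv.swap j k) = f (x + unitDiff j k) - f x := fun x => by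
    rw [comp_swap_eq x hjk]
    exact hf.increment_add x h h _
  have haut : ∀ i, i ≠ j → i ≠ k → Equiv.swap j k i = i ∧
      (1 : Fin n → Equiv.Perm (ZMod 3)) i = Equiv.refl (ZMod 3) :=
    fun i hi hi' => ⟨Equiv.swap_apply_of_ne_of_ne hi hi', rfl⟩
  refine .single ⟨hφ.graphCode_mem hs hK hf b,
    hφ.graphCode_mem hs hK (hφ.isLatin_straighten hf hjk h s) b,
    ⟨j, k, Equiv.swap j k, 1, haut, fun x hx => ?_⟩,
    ⟨j, k, Equiv.swap j k, 1, haut, fun x hx => ?_⟩⟩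
  · by_cases hx' : f (x + unitDiff j k) - f x = s
    · exact .inl ⟨hx.1, hx.2.trans (straighten_of_eq hx')⟩
    · refine .inr ⟨x ∘ Equiv.swap j k, ⟨(hsw x).trans hx.1, ?_⟩, hss x⟩
      rw [hso, hx.2, straighten_of_ne hx']
  · by_cases hx' : f (x + unitDiff j k) - f x = s
    · exact .inl ⟨hx.1, hx.2.trans (straighten_of_eq hx').symm⟩
    · refine .inr ⟨x ∘ Equiv.swap j k, ⟨(hsw x).trans hx.1, ?_⟩, hss x⟩
      rw [hso, hx.2, straighten_of_ne (by rwa [hcond]), hss]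

/-- All increments of a Latin function can be made standard. -/
theorem IsBlockMap.exists_standard_increments [Module.Finite (ZMod 3) K] (hφ : IsBlockMap φ o)
    (hs : Function.Surjective φ) (hK : Module.finrank (ZMod 3) K + 1 = m)
    (τ : Fin n → ZMod 3)
    (hτ : ∀ j k, j ≠ k → φ (Pi.single j 1) = φ (Pi.single k 1) → τ j ≠ τ k)
    (hf : IsLatin φ o f) (S : Finset (Fin n)) :
    ∃ g, IsLatin φ o g ∧ SwitchConnected n m 1 (graphCode φ b o f) (graphCode φ b o g) ∧
      ∀ i ∈ S, ∀ l, φ (Pi.single i 1) = φ (Pi.single l 1) →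
        ∀ x, g (x + unitDiff i l) - g x = τ i - τ l := by
  induction S using Finset.induction_on with
  | empty => exact ⟨f, hf, .refl, by simp⟩
  | insert a S ha ih =>
    obtain ⟨g, hg, hconn, hS⟩ := ih
    by_cases hak : ∃ k, a ≠ k ∧ φ (Pi.single a 1) = φ (Pi.single k 1)
    · obtain ⟨k, hk, hc⟩ := hak
      have hg' := hφ.isLatin_straighten hg hk hc (τ a - τ k)
      refine ⟨_, hg', hconn.trans (hφ.switchConnected_straighten hs hK hg hk hc (τ a - τ k)), ?_⟩
      have hbase : ∀ x, straighten a k (τ a - τ k) g (x + unitDiff a k) -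
          straighten a k (τ a - τ k) g x = τ a - τ k := by
        intro x
        by_cases hx : g (x + unitDiff a k) - g x = τ a - τ k
        · rw [hg.straighten_increment_of_eq hc hx hc, hx]
        · rw [hg.straighten_increment_of_ne hk hc hx hc, Equiv.swap_apply_left,
            Equiv.swap_apply_right, hg.sub_unitDiff x hk hc]
          -- A wrong nonzero increment is the negative of the right one, and the swap reverses its
          -- sign.
          have key : ∀ p q : ZMod 3, p ≠ 0 → q ≠ 0 → p ≠ q → -p = q := by decide
          exact key _ _ (sub_ne_zero.2 (hg.ne x a k hk hc)) (sub_ne_zero.2 (hτ a k hk hc)) hx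
      intro i hi l hil x
      -- The block of `a` is settled by the single increment `hbase`; the swap does not touch the
      -- other blocks.
      by_cases hia : φ (Pi.single i 1) = φ (Pi.single a 1)
      · exact hg'.increment_eq τ hτ x hk hc (hbase x) i l hia (hil.symm.trans hia)
      · have hiS : i ∈ S := (Finset.mem_insert.1 hi).resolve_left (fun h => hia (by rw [h]))
        by_cases hx : g (x + unitDiff a k) - g x = τ a - τ k
        · rw [hg.straighten_increment_of_eq hc hx hil, hS i hiS l hil]
        · have hne : ∀ p, φ (Pi.single p 1) = φ (Pi.single i 1) → p ≠ a ∧ p ≠ k := fun p hp =>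
            ⟨fun h => hia (by rw [← hp, h]), fun h => hia (by rw [← hp, h, hc])⟩
          rw [hg.straighten_increment_of_ne hk hc hx hil,
            Equiv.swap_apply_of_ne_of_ne (hne i rfl).1 (hne i rfl).2,
            Equiv.swap_apply_of_ne_of_ne (hne l hil.symm).1 (hne l hil.symm).2, hS i hiS l hil]
    · refine ⟨g, hg, hconn, fun i hi l hil x => ?_⟩
      rcases Finset.mem_insert.1 hi with rfl | hi
      · have : i = l := by
          by_contra h
          exact hak ⟨l, h, hil⟩
        subst this
        simp [unitDiff]
      · exact hS i hi l hil x

open Classical in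
/-- An additive term of a graph code that is constant along same-image differences can be set to
zero where it takes a given value. -/
theorem IsBlockMap.switchConnected_erase_value [Module.Finite (ZMod 3) K] (hφ : IsBlockMap φ o)
    (hs : Function.Surjective φ) (hK : Module.finrank (ZMod 3) K + 1 = m)
    {Λ g : TernaryWord n → ZMod 3} (hΛ : IsLatin φ o Λ)
    (hgo : ∀ x t, g (x + Pi.single o t) = g x)
    (hg : ∀ x j k, φ (Pi.single j 1) = φ (Pi.single k 1) → g (x + unitDiff j k) = g x)
    (c : ZMod 3) :
    SwitchConnected n m 1 (graphCode φ b o (fun x => Λ x + g x))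
      (graphCode φ b o (fun x => Λ x + if g x = c then 0 else g x)) := by
  have hL : ∀ h : ZMod 3 → ZMod 3, IsLatin φ o (fun x => Λ x + h (g x)) := fun h =>
    ⟨fun x t => by simp only [hΛ.add_single, hgo], fun x j k hjk hc => by
      simp only [hg x j k hc, ne_eq, add_left_inj]
      exact hΛ.ne x j k hjk hc⟩
  have hshift : ∀ (d : ZMod 3) (x : TernaryWord n),
      hammingAut 1 (Function.update 1 o (Equiv.addRight d)) x = x + Pi.single o d := by
    intro d x
    funext k
    change Function.update (1 : Fin n → Equiv.Perm (ZMod 3)) o (Equiv.addRight d) k (x k) = _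
    rcases eq_or_ne k o with rfl | hk
    · simp
    · simp [hk]
  have haut : ∀ (d : ZMod 3) (k : Fin n), k ≠ o → k ≠ o → (1 : Equiv.Perm (Fin n)) k = k ∧
      Function.update (1 : Fin n → Equiv.Perm (ZMod 3)) o (Equiv.addRight d) k =
        Equiv.refl (ZMod 3) := fun d k hk _ => ⟨rfl, by rw [Function.update_of_ne hk]; rfl⟩
  have hφo : ∀ x d, φ (x + Pi.single o d) = φ x := fun x d => by
    rw [map_add, map_single_eq_smul, (hφ.zero_iff o).2 rfl, smul_zero, add_zero]
  have hback : ∀ (x : TernaryWord n) (d : ZMod 3), x + Pi.single o d + Pi.single o (-d) = x :=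
    fun x d => by rw [add_assoc, ← Pi.single_add, add_neg_cancel, Pi.single_zero, add_zero]
  -- Codewords with `g x = c` are shifted by `-c` in coordinate `o`, which affects neither `φ` nor
  -- `g`. The inverse shift is written `- -c` to match `hback`.
  refine .single ⟨hφ.graphCode_mem hs hK (hL id) b,
    hφ.graphCode_mem hs hK (hL fun z => if z = c then 0 else z) b,
    ⟨o, o, 1, _, haut (-c), fun x hx => ?_⟩, ⟨o, o, 1, _, haut (- -c), fun x hx => ?_⟩⟩
  · by_cases hx' : g x = c
    · refine .inr ⟨x + Pi.single o c, ⟨(hφo _ _).trans hx.1, ?_⟩, ?_⟩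
      · simp only [hΛ.add_single, hgo, hx', Pi.add_apply, Pi.single_eq_same, add_left_inj]
        simpa [hx'] using hx.2
      · rw [hshift, hback]
    · exact .inl ⟨hx.1, by simpa [hx'] using hx.2⟩
  · by_cases hx' : g x = c
    · refine .inr ⟨x + Pi.single o (-c), ⟨(hφo _ _).trans hx.1, ?_⟩, ?_⟩
      · simp only [hΛ.add_single, hgo, hx', Pi.add_apply, Pi.single_eq_same]
        simp [hx.2, hx']
      · rw [hshift, hback]
    · exact .inl ⟨hx.1, by simpa [hx'] using hx.2⟩

/-- All graph codes of Latin functions are connected to the one of a Latin linear function. -/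
theorem IsBlockMap.switchConnected_linear [Module.Finite (ZMod 3) K] (hφ : IsBlockMap φ o)
    (hs : Function.Surjective φ) (hK : Module.finrank (ZMod 3) K + 1 = m)
    {Λ : TernaryWord n →ₗ[ZMod 3] ZMod 3} (hΛ : IsLatin φ o Λ) (hf : IsLatin φ o f) :
    SwitchConnected n m 1 (graphCode φ b o f) (graphCode φ b o Λ) := by
  classical
  have hinc : ∀ j k, Λ (Pi.single j 1) - Λ (Pi.single k 1) = Λ (unitDiff j k) := fun j k => by
    rw [unitDiff, map_sub]
  obtain ⟨g, hg, hconn, hS⟩ := hφ.exists_standard_increments (b := b) hs hK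
    (fun j => Λ (Pi.single j 1)) (fun j k hjk hc => by
      have := hΛ.ne 0 j k hjk hc
      rw [map_add, map_zero, zero_add, unitDiff, map_sub] at this
      exact sub_ne_zero.1 this) hf Finset.univ
  refine hconn.trans ?_
  obtain ⟨d, hd⟩ : ∃ d : TernaryWord n → ZMod 3, g = fun x => Λ x + d x :=
    ⟨fun x => g x - Λ x, by simp⟩
  have hdo : ∀ x t, d (x + Pi.single o t) = d x := fun x t => by
    have := hg.add_single x t
    simpa only [hd, hΛ.add_single, add_right_inj] using this
  have hdd : ∀ x j k, φ (Pi.single j 1) = φ (Pi.single k 1) → d (x + unitDiff j k) = d x := by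
    intro x j k hc
    have := hS j (Finset.mem_univ _) k hc x
    simp only [hinc, hd, map_add] at this
    linear_combination this
  subst hd
  -- The values 1 and 2 are erased in turn, leaving `d = 0`.
  have h1 := hφ.switchConnected_erase_value (b := b) hs hK hΛ hdo hdd 1
  have h2 := hφ.switchConnected_erase_value (b := b) (g := fun x => if d x = 1 then 0 else d x)
    hs hK hΛ (fun x t => by simp only [hdo]) (fun x j k hc => by simp only [hdd x j k hc]) 2
  refine (h1.trans h2).trans ?_
  have e : (fun x => Λ x + if (if d x = 1 then 0 else d x) = 2 then 0 else
      if d x = 1 then 0 else d x) = Λ := by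
    funext x
    have key : ∀ z : ZMod 3, (if (if z = 1 then 0 else z) = 2 then 0 else
      if z = 1 then 0 else z) = 0 := by decide
    have := key (d x)
    convert add_zero (Λ x) using 2
  rw [e]

end Switching

/-! ### Structure of perfect codes inside a fibre -/

section Structure

variable {K : Type*} [AddCommGroup K] [Module (ZMod 3) K]
variable {φ : TernaryWord n →ₗ[ZMod 3] K} {o : Fin n} {b : K} {C : Set (TernaryWord n)}

theorem IsOnePerfectCode.nonempty (hC : IsOnePerfectCode (ternaryHammingGraph n) C) :
    C.Nonempty := by
  obtain ⟨e, he, -⟩ := isOnePerfectCode_iff.1 hC 0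
  exact ⟨_, he⟩

theorem IsOnePerfectCode.eq_of_add_eq (hC : IsOnePerfectCode (ternaryHammingGraph n) C)
    {v x y : TernaryWord n} (hx : x ∈ C) (hy : y ∈ C) {e e' : Option (Fin n × (ZMod 3)ˣ)}
    (h : v + ballVec e = x) (h' : v + ballVec e' = y) : e = e' :=
  (isOnePerfectCode_iff.1 hC v).unique (by rwa [h]) (by rwa [h'])

theorem IsOnePerfectCode.single_eq (hC : IsOnePerfectCode (ternaryHammingGraph n) C)
    {x : TernaryWord n} {s t : ZMod 3} (hs : x + Pi.single o s ∈ C) (ht : x + Pi.single o t ∈ C) :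
    s = t := by
  by_contra hst
  have hne : t - s ≠ 0 := sub_ne_zero.2 (Ne.symm hst)
  have := hC.eq_of_add_eq hs ht (v := x + Pi.single o s) (e := none)
    (e' := some (o, Units.mk0 _ hne)) (by simp [ballVec])
    (by simp [ballVec, add_assoc, ← Pi.single_add])
  simp at this

/-- The images of the vectors of the unit ball under a linear map that is constant on a perfect
code cover the codomain uniformly. -/
theorem IsOnePerfectCode.card_ball_fiber [Fintype K] [DecidableEq K]
    (hC : IsOnePerfectCode (ternaryHammingGraph n) C)
    (hs : Function.Surjective φ) (hb : ∀ x ∈ C, φ x = b) (r : K) :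
    Fintype.card K * (Finset.univ.filter fun e => φ (ballVec e) = r).card = 2 * n + 1 := by
  classical
  have hfib : ∀ p : K, (Finset.univ.filter fun v => φ v = p).card =
      (Finset.univ.filter fun v => φ v = 0).card := by
    intro p
    obtain ⟨v₀, rfl⟩ := hs p
    refine Finset.card_equiv (Equiv.subRight v₀) fun v => ?_
    simp [sub_eq_zero]
  -- By perfectness, `(x, e) ↦ x - ballVec e` is a bijection from the pairs with `x ∈ C` and `φ
  -- (ballVec e) = p` onto the fibre over `b - p`, and all fibres have equal size.
  have hprod : ∀ p : K, (Finset.univ.filter fun x => x ∈ C).card *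
      (Finset.univ.filter fun e => φ (ballVec e) = p).card =
      (Finset.univ.filter fun v => φ v = 0).card := by
    intro p
    rw [← hfib (b - p), ← Finset.card_product]
    refine Finset.card_bij (fun a _ => a.1 - ballVec a.2) ?_ ?_ ?_
    · rintro ⟨x, e⟩ h
      simp only [Finset.mem_product, Finset.mem_filter, Finset.mem_univ, true_and] at h ⊢
      rw [map_sub, hb x h.1, h.2]
    · rintro ⟨x, e⟩ h ⟨x', e'⟩ h' heq
      simp only [Finset.mem_product, Finset.mem_filter, Finset.mem_univ, true_and] at h h' heq
      have he := hC.eq_of_add_eq h.1 h'.1 (v := x - ballVec e) (e := e) (e' := e') (by simp)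
        (by simp [heq])
      subst he
      rw [sub_left_injective heq]
    · intro v hv
      obtain ⟨e, he, -⟩ := isOnePerfectCode_iff.1 hC v
      refine ⟨(v + ballVec e, e), ?_, by simp⟩
      simp only [Finset.mem_product, Finset.mem_filter, Finset.mem_univ, true_and] at hv ⊢
      have := hb _ he
      rw [map_add, hv] at this
      exact ⟨he, by rw [← sub_eq_zero, ← sub_eq_zero.2 this]; abel⟩
  have hpos : 0 < (Finset.univ.filter fun x => x ∈ C).card :=
    Finset.card_pos.2 (hC.nonempty.imp fun x hx => by simpa using hx)
  have hconst : ∀ p, (Finset.univ.filter fun e => φ (ballVec e) = p).card =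
      (Finset.univ.filter fun e => φ (ballVec e) = r).card := fun p =>
    Nat.eq_of_mul_eq_mul_left hpos ((hprod p).trans (hprod r).symm)
  have hsum := Finset.card_eq_sum_card_fiberwise (s := Finset.univ) (t := Finset.univ)
    (f := fun e : Option (Fin n × (ZMod 3)ˣ) => φ (ballVec e)) (by simp)
  simp only [hconst, Finset.sum_const, smul_eq_mul, Finset.card_univ] at hsum
  rw [← hsum, Fintype.card_option, Fintype.card_prod, Fintype.card_fin, ZMod.card_units]
  ring

theorem units_zmod_three (u w : (ZMod 3)ˣ) : u = w ∨ u = -w := by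
  revert u w
  decide

theorem map_ballVec_some (φ : TernaryWord n →ₗ[ZMod 3] K) (j : Fin n) (u : (ZMod 3)ˣ) :
    φ (ballVec (some (j, u))) = u • φ (Pi.single j 1) := by
  rw [ballVec, map_single_eq_smul, Units.smul_def]

/-- The fibre over zero contains the zero vector and so just one pair `± e_o`. Over `r ≠ 0`,
normalization excludes opposite signs, so the three vectors sit at distinct coordinates. -/
theorem exists_isBlockMap [DecidableEq K]
    (hnorm : ∀ j k, φ (Pi.single j 1) = -φ (Pi.single k 1) → φ (Pi.single j 1) = 0)
    (hcard : ∀ r, (Finset.univ.filter fun e => φ (ballVec e) = r).card = 3) :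
    ∃ o, IsBlockMap φ o := by
  have hz : ∀ j (u : (ZMod 3)ˣ), φ (ballVec (some (j, u))) = 0 ↔ φ (Pi.single j 1) = 0 :=
    fun j u => by rw [map_ballVec_some, smul_eq_zero_iff_eq]
  obtain ⟨e, he, hne⟩ := Finset.exists_mem_ne (by rw [hcard 0]; decide) none
  obtain ⟨⟨o, u⟩, rfl⟩ := Option.ne_none_iff_exists'.1 hne
  have ho : φ (Pi.single o 1) = 0 := by simpa [hz] using he
  refine ⟨o, ⟨fun j => ⟨fun hj => ?_, fun h => h ▸ ho⟩, fun r hr => ?_⟩⟩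
  · by_contra hjo
    -- A second zero column would put a fourth vector over zero.
    have hsub : ({none, some (o, 1), some (o, -1), some (j, 1)} :
        Finset (Option (Fin n × (ZMod 3)ˣ))) ⊆
        Finset.univ.filter fun e => φ (ballVec e) = 0 := by
      intro e he
      simp only [Finset.mem_insert, Finset.mem_singleton] at he
      rcases he with rfl | rfl | rfl | rfl
      · exact Finset.mem_filter.2 ⟨Finset.mem_univ _, map_zero φ⟩
      all_goals simp [hz, ho, hj]
    have h1 : (1 : (ZMod 3)ˣ) ≠ -1 := by decide
    have := Finset.card_le_card hsub
    rw [hcard, Finset.card_insert_of_notMem (by simp),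
      Finset.card_insert_of_notMem (by simp [h1, Ne.symm hjo]),
      Finset.card_insert_of_notMem (by simp [Ne.symm hjo]), Finset.card_singleton] at this
    omega
  · obtain ⟨e₁, e₂, e₃, h12, h13, h23, hset⟩ := Finset.card_eq_three.1 (hcard r)
    have hmem : ∀ e, φ (ballVec e) = r ↔ e = e₁ ∨ e = e₂ ∨ e = e₃ := fun e => by
      have := Finset.ext_iff.1 hset e
      simpa using this
    have hsome : ∀ e, φ (ballVec e) = r → ∃ a, e = some a := by
      rintro (_ | a) h
      · exact absurd (by simpa [ballVec] using h.symm) hr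
      · exact ⟨a, rfl⟩
    have hunit : ∀ j k (u w : (ZMod 3)ˣ), φ (ballVec (some (j, u))) = r →
        φ (ballVec (some (k, w))) = r → u = w := by
      intro j k u w h h'
      refine (units_zmod_three u w).resolve_right fun huw => ?_
      subst huw
      have h0 : φ (Pi.single j 1) = 0 := by
        refine hnorm j k ?_
        have := h.trans h'.symm
        rw [map_ballVec_some, map_ballVec_some, Units.neg_smul, ← smul_neg,
          smul_left_cancel_iff] at this
        rw [← this, neg_neg]
      rw [(hz _ _).2 h0] at h
      exact hr h.symm
    obtain ⟨⟨j₁, u₁⟩, rfl⟩ := hsome e₁ ((hmem _).2 (by simp))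
    obtain ⟨⟨j₂, u₂⟩, rfl⟩ := hsome e₂ ((hmem _).2 (by simp))
    obtain ⟨⟨j₃, u₃⟩, rfl⟩ := hsome e₃ ((hmem _).2 (by simp))
    obtain rfl := hunit j₁ j₂ u₁ u₂ ((hmem _).2 (by simp)) ((hmem _).2 (by simp))
    obtain rfl := hunit j₁ j₃ u₁ u₃ ((hmem _).2 (by simp)) ((hmem _).2 (by simp))
    refine ⟨u₁, j₁, j₂, j₃, fun h => h12 (by rw [h]), fun h => h13 (by rw [h]),
      fun h => h23 (by rw [h]), fun k w => ?_⟩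
    rw [hmem]
    simp only [Option.some.injEq, Prod.mk.injEq]
    tauto

/-- The coefficients of `Λ` number the columns of each block by 0, 1, 2; the coefficient at `o` is
0. -/
theorem IsBlockMap.exists_linear_isLatin (hφ : IsBlockMap φ o) :
    ∃ Λ : TernaryWord n →ₗ[ZMod 3] ZMod 3, IsLatin φ o Λ := by
  have hτ : ∀ p : K, ∃ τ : Fin n → ZMod 3, p ≠ 0 → ∀ j k, φ (Pi.single j 1) = p →
      φ (Pi.single k 1) = p → j ≠ k → τ j ≠ τ k := by
    intro p
    by_cases hp : p = 0
    · exact ⟨0, fun h => absurd hp h⟩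
    obtain ⟨u, j₁, j₂, j₃, h12, h13, h23, hblock⟩ := hφ.block p hp
    refine ⟨fun k => if k = j₁ then 0 else if k = j₂ then 1 else 2, fun _ j k hj hk hjk => ?_⟩
    have hin : ∀ i, φ (Pi.single i 1) = p → i = j₁ ∨ i = j₂ ∨ i = j₃ := fun i hi =>
      ((hblock i 1).1 (by rw [map_ballVec_some, one_smul, hi])).2
    have d1 : (0 : ZMod 3) ≠ 1 := by decide
    have d2 : (0 : ZMod 3) ≠ 2 := by decide
    have d3 : (1 : ZMod 3) ≠ 2 := by decide
    rcases hin j hj with rfl | rfl | rfl <;> rcases hin k hk with rfl | rfl | rfl <;>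
      simp_all [Ne.symm, eq_comm]
  choose τ hτ using hτ
  let σ : Fin n → ZMod 3 := fun j => if j = o then 0 else τ (φ (Pi.single j 1)) j
  let Λ : TernaryWord n →ₗ[ZMod 3] ZMod 3 := ∑ j, σ j • LinearMap.proj j
  have hΛ : ∀ j t, Λ (Pi.single j t) = σ j * t := fun j t => by
    simp [Λ, Pi.single_apply]
  refine ⟨Λ, fun x t => ?_, fun x j k hjk hc => ?_⟩
  · simp [map_add, hΛ, σ]
  · obtain ⟨hj, hk⟩ := hφ.ne_of_eq hjk hc
    rw [map_add, unitDiff, map_sub, hΛ, hΛ]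
    simp only [σ, hj.symm, hk.symm, if_false, mul_one, ne_eq, add_eq_left, sub_eq_zero, hc]
    exact hτ _ (fun h => hk.symm ((hφ.zero_iff k).1 h)) j k hc rfl hjk

/-- Perfect codes on which a block map is constant are graph codes of Latin functions. -/
theorem IsBlockMap.exists_eq_graphCode (hφ : IsBlockMap φ o)
    (hC : IsOnePerfectCode (ternaryHammingGraph n) C) (hb : ∀ x ∈ C, φ x = b) :
    ∃ f, IsLatin φ o f ∧ C = graphCode φ b o f := by
  classical
  obtain ⟨Λ, hΛ⟩ := hφ.exists_linear_isLatin
  have hex : ∀ x, ∃ t, φ x = b → x + Pi.single o t ∈ C := by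
    intro x
    by_cases hx : φ x = b
    · obtain ⟨e, he, -⟩ := isOnePerfectCode_iff.1 hC x
      rcases e with _ | ⟨j, u⟩
      · exact ⟨0, fun _ => by simpa [ballVec] using he⟩
      · have := hb _ he
        rw [map_add, hx, add_eq_left, map_ballVec_some, smul_eq_zero_iff_eq, hφ.zero_iff] at this
        subst this
        exact ⟨u, fun _ => he⟩
    · exact ⟨0, fun h => absurd h hx⟩
  choose t ht using hex
  have hφo : ∀ x s, φ (x + Pi.single o s) = φ x := fun x s => by
    rw [map_add, map_single_eq_smul, (hφ.zero_iff o).2 rfl, smul_zero, add_zero]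
  -- `t x` is the correction of coordinate `o` that leads into `C`. Off the fibre the code does not
  -- see `f`, but the Latin condition is still required, so `Λ` fills in.
  refine ⟨fun x => if φ x = b then x o + t x else Λ x, ⟨fun x s => ?_, fun x j k hjk hc => ?_⟩, ?_⟩
  · simp only [hφo]
    split_ifs with hx
    · have h1 := ht _ ((hφo x s).trans hx)
      rw [add_assoc, ← Pi.single_add] at h1
      rw [← hC.single_eq h1 (ht x hx), Pi.add_apply, Pi.single_eq_same, add_assoc]
    · exact hΛ.add_single x s
  · have hd : φ (x + unitDiff j k) = φ x := by rw [map_add, map_unitDiff hc, add_zero]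
    obtain ⟨hj, hk⟩ := hφ.ne_of_eq hjk hc
    simp only [hd]
    split_ifs with hx
    · intro heq
      have ho : (unitDiff j k : TernaryWord n) o = 0 := by simp [unitDiff, hj, hk]
      rw [Pi.add_apply, ho, add_zero, add_right_inj] at heq
      have h2 := ht _ (hd.trans hx)
      rw [heq] at h2
      -- Equal values would give codewords `y` and `y + e_j - e_k`, both adjacent to `y + e_j`.
      have := hC.eq_of_add_eq (ht x hx) h2 (v := x + Pi.single o (t x) + Pi.single j 1)
        (e := some (j, -1)) (e' := some (k, -1))
        (by simp only [ballVec, Units.val_neg, Units.val_one, Pi.single_neg]; abel)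
        (by simp only [ballVec, Units.val_neg, Units.val_one, Pi.single_neg, unitDiff]; abel)
      simp only [Option.some.injEq, Prod.mk.injEq, and_true] at this
      exact hjk this
    · exact hΛ.ne x j k hjk hc
  · ext x
    constructor
    · intro hx
      have h0 : t x = 0 := hC.single_eq (ht x (hb x hx)) (by simpa using hx)
      exact ⟨hb x hx, by simp [hb x hx, h0]⟩
    · rintro ⟨h1, h2⟩
      have h0 : t x = 0 := by simpa [h1] using h2
      simpa [h0] using ht x h1

end Structure

/-! ### Finding and normalizing the check map -/

theorem exists_surjective_of_finrank_add_le {V : Type*} [AddCommGroup V] [Module (ZMod 3) V]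
    [Module.Finite (ZMod 3) V] (W : Submodule (ZMod 3) V) {q : ℕ}
    (h : Module.finrank (ZMod 3) W + q ≤ Module.finrank (ZMod 3) V) :
    ∃ φ : V →ₗ[ZMod 3] (Fin q → ZMod 3), Function.Surjective φ ∧ W ≤ LinearMap.ker φ := by
  have hq := Submodule.finrank_quotient_add_finrank W
  have hle : q ≤ Module.finrank (ZMod 3) (V ⧸ W) := by omega
  let e := (Module.finBasis (ZMod 3) (V ⧸ W)).equivFun
  refine ⟨(LinearMap.funLeft (ZMod 3) (ZMod 3) (Fin.castLE hle)) ∘ₗ e.toLinearMap ∘ₗ W.mkQ, ?_, ?_⟩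
  · exact (LinearMap.funLeft_surjective_of_injective (ZMod 3) (ZMod 3) _ (Fin.castLE_injective hle)).comp
      (e.surjective.comp W.mkQ_surjective)
  · intro x hx
    have : W.mkQ x = 0 := by simpa using hx
    simp [LinearMap.mem_ker, LinearMap.comp_apply, (Submodule.Quotient.mk_eq_zero W).2 hx]

/-- There is a choice of signs that identifies opposite vectors. -/
theorem exists_sign_normalization (K : Type*) [AddCommGroup K] [Module (ZMod 3) K] [Finite K] :
    ∃ s : K → (ZMod 3)ˣ, ∀ p, s (-p) • (-p) = s p • p := by
  classical
  obtain ⟨N, ⟨e⟩⟩ := Finite.exists_equiv_fin K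
  -- Of `p` and `-p`, the one that comes first in an enumeration is chosen.
  refine ⟨fun p => if e p ≤ e (-p) then 1 else -1, fun p => ?_⟩
  simp only [neg_neg]
  rcases lt_trichotomy (e p) (e (-p)) with h | h | h
  · simp [h.le, h.not_ge]
  · rw [← e.injective h]
  · simp [h.le, h.not_ge]

theorem eq_zero_of_eq_neg_self {K : Type*} [AddCommGroup K] [Module (ZMod 3) K] {p : K}
    (h : p = -p) : p = 0 := by
  have h2 : (2 : ZMod 3) • p = 0 := by
    rw [two_smul]
    nth_rewrite 1 [h]
    exact neg_add_cancel p
  exact (smul_eq_zero_iff_right (by decide : (2 : ZMod 3) ≠ 0)).1 h2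

/-- A code of rank at most `+1` is connected to one on which a surjective linear map with
normalized images of unit vectors is constant. -/
theorem exists_normalized_check_map (hm : 1 ≤ m) (hn : 2 * n + 1 = 3 ^ m)
    {C : Set (TernaryWord n)} (hC : C ∈ onePerfectCodesOfRankLE n m 1) :
    ∃ D, SwitchConnected n m 1 C D ∧ ∃ φ : TernaryWord n →ₗ[ZMod 3] (Fin (m - 1) → ZMod 3),
      Function.Surjective φ ∧ (∃ b, ∀ x ∈ D, φ x = b) ∧
      ∀ j k, φ (Pi.single j 1) = -φ (Pi.single k 1) → φ (Pi.single j 1) = 0 := by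
  -- Bernoulli's inequality; it keeps the subtraction in `n - m` from truncating.
  have hmn : m ≤ n := by
    have := one_add_mul_le_pow (show (-2 : ℤ) ≤ 2 by norm_num) m
    zify at hn ⊢
    norm_num at this
    linarith
  have hr := hC.2
  rw [codeRank, direction_affineSpan] at hr
  obtain ⟨φ, hφ, hker⟩ := exists_surjective_of_finrank_add_le (vectorSpan (ZMod 3) C) (q := m - 1)
    (by rw [Module.finrank_fin_fun]; omega)
  obtain ⟨s, hs⟩ := exists_sign_normalization (Fin (m - 1) → ZMod 3)
  let a : Fin n → (ZMod 3)ˣ := fun j => s (φ (Pi.single j 1))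
  let L : TernaryWord n ≃ₗ[ZMod 3] TernaryWord n :=
    LinearEquiv.piCongrRight fun j => LinearEquiv.smulOfUnit (a j)
  have hLs : ∀ j, L (Pi.single j 1) = (a j : ZMod 3) • Pi.single j 1 := fun j => by
    funext k
    change a k • (Pi.single j 1 : TernaryWord n) k = _
    rcases eq_or_ne k j with rfl | hk
    · simp [Units.smul_def]
    · simp [hk]
  obtain ⟨c, hc⟩ := hC.1.nonempty
  have himg : L ∘ L = id := by
    funext x k
    change a k • a k • x k = x k
    rw [smul_smul]
    rcases units_zmod_three (a k) 1 with h | h <;> simp [h]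
  let θ : Fin n → Equiv.Perm (ZMod 3) := fun j => MulAction.toPerm (a j)
  have hθ : hammingAut 1 θ = L := rfl
  refine ⟨_, switchConnected_image hC 1 θ, φ ∘ₗ L.toLinearMap, hφ.comp L.surjective,
    ⟨φ c, ?_⟩, fun j k h => ?_⟩
  · rintro _ ⟨x, hx, rfl⟩
    rw [hθ, LinearMap.comp_apply, LinearEquiv.coe_coe, show L (L x) = x from congrFun himg x,
      ← sub_eq_zero, ← map_sub]
    exact hker (vsub_mem_vectorSpan _ hx hc)
  · simp only [LinearMap.comp_apply, LinearEquiv.coe_coe, hLs, map_smul] at h ⊢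
    simp only [a, ← Units.smul_def] at h ⊢
    set p := φ (Pi.single j 1)
    set q := φ (Pi.single k 1)
    have hpq : p = q ∨ p = -q := by
      rcases units_zmod_three (s p) (s q) with hu | hu
      · rw [hu, ← smul_neg, smul_left_cancel_iff] at h
        exact .inr h
      · rw [hu, Units.neg_smul, neg_inj, smul_left_cancel_iff] at h
        exact .inl h
    -- Columns equal up to sign become equal, so a normalized column opposite to another is its own
    -- negative.
    have heq : s p • p = s q • q := by
      rcases hpq with h' | h'
      · rw [h']
      · rw [h', hs]
    rw [← heq] at h
    exact eq_zero_of_eq_neg_self h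

/-! ### Uniqueness of the Hamming code and conclusion -/

section Hamming

variable {K : Type*} [AddCommGroup K] [Module (ZMod 3) K]

/-- Affine Hamming codes given by parity checks with the same codomain are equivalent. -/
theorem exists_hammingAut_image_eq (Φ Ψ : TernaryWord n →ₗ[ZMod 3] K)
    (hΦ : ∀ r, ∃! e, Φ (ballVec e) = r) (hΨ : ∀ r, ∃! e, Ψ (ballVec e) = r) (b d : K) :
    ∃ π θ, hammingAut π θ '' {x | Φ x = b} = {x | Ψ x = d} := by
  have hex : ∀ j, ∃ k, ∃ u : (ZMod 3)ˣ, Ψ (ballVec (some (k, u))) = Φ (Pi.single j 1) := by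
    intro j
    obtain ⟨e, he, -⟩ := hΨ (Φ (Pi.single j 1))
    rcases e with _ | ⟨k, u⟩
    · have h0 : Φ (ballVec (some (j, 1))) = 0 := by
        rw [map_ballVec_some, one_smul, ← he, ballVec, map_zero]
      exact absurd ((hΦ 0).unique h0 (y₂ := none) (by simp [ballVec])) (by simp)
    · exact ⟨k, u, he⟩
  choose p u hpu using hex
  -- If columns `j` and `k` of `Φ` matched the same column of `Ψ`, they would be proportional,
  -- against the uniqueness in `hΦ`.
  have hinj : Function.Injective p := by
    intro j k hjk
    have h : Φ (ballVec (some (j, u k))) = Φ (ballVec (some (k, u j))) := by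
      rw [map_ballVec_some, map_ballVec_some, ← hpu, ← hpu, map_ballVec_some, map_ballVec_some,
        hjk, smul_comm]
    have := (hΦ _).unique h rfl
    simp only [Option.some.injEq, Prod.mk.injEq] at this
    exact this.1
  let π : Equiv.Perm (Fin n) := Equiv.ofBijective p (Finite.injective_iff_bijective.1 hinj)
  -- Translation by `ballVec e` accounts for the different right-hand sides `b` and `d`.
  obtain ⟨e, he, -⟩ := hΨ (d - b)
  let θ : Fin n → Equiv.Perm (ZMod 3) := fun k =>
    (MulAction.toPerm (u (π.symm k))).trans (Equiv.addRight (ballVec e k))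
  have hmap : ∀ x, Ψ (hammingAut π θ x) = Φ x + (d - b) := by
    intro x
    have h1 : hammingAut π θ x = ∑ j, x j • ballVec (some (π j, u j)) + ballVec e := by
      funext k
      obtain ⟨j, rfl⟩ := π.surjective k
      rw [Pi.add_apply, Finset.sum_apply, Finset.sum_eq_single j]
      · simp [hammingAut, θ, ballVec, Units.smul_def, mul_comm]
      · intro i _ hij
        simp [ballVec, π.injective.ne hij.symm]
      · simp
    have h2 : Φ x = ∑ j, x j • Φ (Pi.single j 1) := by
      conv_lhs => rw [← Finset.univ_sum_single x, map_sum]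
      exact Finset.sum_congr rfl fun j _ => map_single_eq_smul Φ j (x j)
    rw [h1, map_add, he, map_sum, h2]
    congr 1
    refine Finset.sum_congr rfl fun j _ => ?_
    rw [map_smul, ← hpu]
    rfl
  refine ⟨π, θ, Set.ext fun y => ?_⟩
  obtain ⟨x, rfl⟩ := hammingAut_surjective π θ y
  rw [(hammingAut_injective π θ).mem_set_image]
  change Φ x = b ↔ Ψ _ = d
  rw [hmap, ← eq_sub_iff_add_eq, sub_sub_cancel]

/-- The parity checks of a perfect code distinguish the vectors of the unit ball. -/
theorem existsUnique_map_ballVec {Φ : TernaryWord n →ₗ[ZMod 3] K} (hs : Function.Surjective Φ)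
    {b : K} (hC : IsOnePerfectCode (ternaryHammingGraph n) {x | Φ x = b}) (r : K) :
    ∃! e, Φ (ballVec e) = r := by
  obtain ⟨v, hv⟩ := hs (b - r)
  have := isOnePerfectCode_iff.1 hC v
  have h : ∀ e, v + ballVec e ∈ {x | Φ x = b} ↔ Φ (ballVec e) = r := fun e => by
    change Φ _ = b ↔ _
    rw [map_add, hv, ← eq_sub_iff_add_eq', sub_sub_cancel]
  simpa only [h] using this

end Hamming

/-- Each code of rank at most `+1` is connected to an affine Hamming code. -/
theorem exists_switchConnected_hamming (hm : 1 ≤ m) (hn : 2 * n + 1 = 3 ^ m)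
    {C : Set (TernaryWord n)} (hC : C ∈ onePerfectCodesOfRankLE n m 1) :
    ∃ (Φ : TernaryWord n →ₗ[ZMod 3] (Fin (m - 1) → ZMod 3) × ZMod 3) (b : _),
      (∀ r, ∃! e, Φ (ballVec e) = r) ∧ SwitchConnected n m 1 C {x | Φ x = b} := by
  classical
  obtain ⟨D, hCD, φ, hs, ⟨b, hb⟩, hnorm⟩ := exists_normalized_check_map hm hn hC
  have hD := hCD.mem hC
  have hcard : ∀ r, (Finset.univ.filter fun e => φ (ballVec e) = r).card = 3 := by
    intro r
    have h := hD.1.card_ball_fiber hs hb r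
    have h3 : 3 ^ m = 3 ^ (m - 1) * 3 := by rw [← pow_succ, Nat.sub_add_cancel hm]
    rw [hn, h3, Fintype.card_fun, ZMod.card, Fintype.card_fin] at h
    exact Nat.eq_of_mul_eq_mul_left (by positivity) h
  obtain ⟨o, hφ⟩ := exists_isBlockMap hnorm hcard
  obtain ⟨f, hf, rfl⟩ := hφ.exists_eq_graphCode hD.1 hb
  obtain ⟨Λ, hΛ⟩ := hφ.exists_linear_isLatin
  have hK : Module.finrank (ZMod 3) (Fin (m - 1) → ZMod 3) + 1 = m := by
    rw [Module.finrank_fin_fun]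
    omega
  have hconn := hφ.switchConnected_linear (b := b) hs hK hΛ hf
  -- The equation `x o = Λ x` serves as the last, `m`-th parity check.
  let Φ : TernaryWord n →ₗ[ZMod 3] (Fin (m - 1) → ZMod 3) × ZMod 3 :=
    φ.prod (LinearMap.proj o - Λ)
  have hset : graphCode φ b o Λ = {x | Φ x = (b, 0)} := by
    ext x
    simp [graphCode, Φ, sub_eq_zero]
  have hΦs : Function.Surjective Φ := by
    rintro ⟨r, t⟩
    obtain ⟨x, rfl⟩ := hs r
    refine ⟨x + Pi.single o (t - (x o - Λ x)), Prod.ext ?_ ?_⟩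
    · change φ _ = φ x
      rw [map_add, map_single_eq_smul, (hφ.zero_iff o).2 rfl, smul_zero, add_zero]
    · change (x + Pi.single o (t - (x o - Λ x)) : TernaryWord n) o - Λ _ = t
      rw [hΛ.add_single, Pi.add_apply, Pi.single_eq_same]
      ring
  refine ⟨Φ, (b, 0), existsUnique_map_ballVec hΦs (hset ▸ hφ.isOnePerfectCode hΛ b), ?_⟩
  rw [← hset]
  exact hCD.trans hconn

theorem theorem3p3 (m n : ℕ) (hm : 1 ≤ m) (hn : n = (3 ^ m - 1) / 2)
    (C D : onePerfectCodesOfRankLE n m 1) :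
    Relation.ReflTransGen
      (fun A B : onePerfectCodesOfRankLE n m 1 =>
        IsTwoCoordinateSwitching (A : Set (TernaryWord n)) (B : Set (TernaryWord n)))
      C D := by
  have hn' : 2 * n + 1 = 3 ^ m := by
    have h1 : 3 ^ m % 2 = 1 := Nat.odd_iff.1 (Odd.pow (by decide))
    generalize 3 ^ m = N at *
    omega
  obtain ⟨Φ, b, hΦ, hC⟩ := exists_switchConnected_hamming hm hn' C.2
  obtain ⟨Ψ, d, hΨ, hD⟩ := exists_switchConnected_hamming hm hn' D.2
  obtain ⟨π, θ, h⟩ := exists_hammingAut_image_eq Φ Ψ hΦ hΨ b d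
  have h2 := switchConnected_image (hC.mem C.2) π θ
  rw [h] at h2
  exact SwitchConnected.reflTransGen ((hC.trans h2).trans hD.symm) C.2 D.2
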